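/- Let $F$ be a field and let $D$ be a central division algebra over $F$, that is, a division algebra with center $F$ and of finite dimension over $F$; let $d=\sqrt{[D:F]}$ be its degree. Let $\phi(z)=z^n+c_{n-1}z^{n-1}+\dots+c_0$ be a standard polynomial over $D$: it is monic, with coefficients $c_i\in D$ written on the left of the variable, and a root of $\phi$ is an element $\lambda\in D$ with $\lambda^n+c_{n-1}\lambda^{n-1}+\dots+c_0=0$. Let $C_\phi\in M_n(D)$ be its companion matrix, which has ones directly above the diagonal, last row $(-c_0,-c_1,\dots,-c_{n-1})$, and zeros elsewhere. For a maximal subfield $K$ of $D$ and an isomorphism $g:D^n\to K^{m}$ of right $K$-vector spaces, let $f(C_\phi)\in M_{m}(K)$ be the matrix with $g(C_\phi v)=f(C_\phi)\,g(v)$ for all $v\in D^n$. Then there is a unique polynomial $\Phi\in F[z]$ (the companion polynomial of $\phi$) such that $\Phi(z)=\det\big(f(C_\phi)-zI\big)$ for all choices of $K$, $m$ and $g$. The degree of $\Phi$ is $nd$. Moreover: 1. every root $\lambda\in D$ of $\phi$ is a root of $\Phi$; 2. every conjugacy class of roots of $\Phi$ in $D$ contains a root of $\phi$: if $\mu\in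 D$ and $\Phi(\mu)=0$, then there is a nonzero $q\in D$ such that $q\mu q^{-1}$ is a root of $\phi$. -/

import Mathlib

namespace CentralDivision

open Polynomial
open scoped IsMulCommutative

/-- The degree `d = √[D : F]` of a central division algebra (its dimension is a perfect square). -/
noncomputable def degree (F D : Type*) [Field F] [DivisionRing D] [Algebra F D] : ℕ :=
  Nat.sqrt (Module.finrank F D)

/-- `K` is a maximal subfield of `D` (every maximal subfield contains the center, so it is enough
to consider the subalgebras of `D` that are fields). -/
def IsMaximalSubfield {F D : Type*} [Field F] [DivisionRing D] [Algebra F D]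
    (K : Subalgebra F D) : Prop :=
  Maximal (fun L : Subalgebra F D => IsField L) K

/-- An isomorphism `g : Dⁿ → Kᵐ` of right `K`-vector spaces, where `K` acts on `Dⁿ` by
multiplication on the right. If `K` is a maximal subfield, it can only exist for `m = n d`. -/
structure RightIso {F D : Type*} [Field F] [DivisionRing D] [Algebra F D]
    (K : Subalgebra F D) (n m : ℕ) where
  /-- The underlying additive isomorphism. -/
  g : (Fin n → D) ≃+ (Fin m → K)
  map_mul_right : ∀ (v : Fin n → D) (k : K), g (fun i => v i * (k : D)) = fun j => g v j * k

/-- The matrix `f(A)` over `K` of the right `K`-linear map `v ↦ A v` on `Dⁿ ≅ Kᵐ`: its `j`-th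
column is `g (A g⁻¹(e_j))`. -/
def RightIso.rep {F D : Type*} [Field F] [DivisionRing D] [Algebra F D]
    {K : Subalgebra F D} {n m : ℕ} (e : RightIso K n m) (A : Matrix (Fin n) (Fin n) D) :
    Matrix (Fin m) (Fin m) K :=
  Matrix.of fun i j => e.g (A.mulVec (e.g.symm (Pi.single j 1))) i

/-- The polynomial `det (f(A) - z I)` over `K`. -/
noncomputable def RightIso.charPoly {F D : Type*} [Field F] [DivisionRing D] [Algebra F D]
    {K : Subalgebra F D} [IsMulCommutative K] {n m : ℕ} (e : RightIso K n m)
    (A : Matrix (Fin n) (Fin n) D) : K[X] :=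
  Matrix.det ((e.rep A).map (C : K → K[X]) - (X : K[X]) • (1 : Matrix (Fin m) (Fin m) K[X]))

/-- `Φ`, with coefficients in `F`, is the characteristic polynomial of `A`: it is equal to
`det (f(A) - z I)` for every maximal subfield `K` and every isomorphism `g : Dⁿ → Kᵐ`. -/
def IsCharPoly {F D : Type*} [Field F] [DivisionRing D] [Algebra F D] {n : ℕ}
    (A : Matrix (Fin n) (Fin n) D) (Φ : F[X]) : Prop :=
  ∀ (K : Subalgebra F D) [IsMulCommutative K], IsMaximalSubfield K →
    ∀ (m : ℕ) (e : RightIso K n m), Φ.map (algebraMap F K) = e.charPoly A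

/-- The companion matrix of `φ(z) = zⁿ + c_{n-1} zⁿ⁻¹ + ⋯ + c_0`: ones above the diagonal, last row
`-c_0, …, -c_{n-1}`, and zeros elsewhere. -/
def companionMatrix {D : Type*} [DivisionRing D] (φ : D[X]) :
    Matrix (Fin φ.natDegree) (Fin φ.natDegree) D :=
  Matrix.of fun i j =>
    if (i : ℕ) + 1 = φ.natDegree then -φ.coeff j
    else if (j : ℕ) = (i : ℕ) + 1 then 1 else 0

/-- `Φ` is the companion polynomial of `φ`. -/
def IsCompanionPolynomial {F D : Type*} [Field F] [DivisionRing D] [Algebra F D]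
    (φ : D[X]) (Φ : F[X]) : Prop :=
  IsCharPoly (companionMatrix φ) Φ

end CentralDivision

/-! Write `T` for `v ↦ A v` on `Dⁿ`; it is right `D`-linear, hence linear over `Dᵐᵒᵖ`. Its
characteristic polynomial over `F` is `Q ^ d` with `Q` monic
(`exists_monic_charpoly_eq_pow_degree`). Indeed, for an irreducible factor `p`, the kernel of `p(T)`
is a nonzero `D`-subspace and a vector space over `L = F[X]/p`; over the algebraic closure of `L`,
`D` becomes a `d × d` matrix algebra, so the `L`-dimension is a multiple of `d`. Induct on the
quotient. For a maximal subfield `K`, `K ⊗ Dⁿ` is `d` copies of `Dⁿ` as a `K`-space with operator,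
so `χ_K(T) ^ d = χ_F(T) = Q ^ d` and `χ_K(T) = Q`, whatever `K` and `g`. Thus `Φ = ± Q`. A root `x`
of `φ` gives the column `(xⁱ)`, on which the companion matrix acts as `x`, and Cayley–Hamilton
applies. Conversely, a root `y` of `Φ` is a right eigenvalue (`exists_mulVec_eq_of_aeval_charpoly`):
the quotient of its minimal polynomial by `z - y`, applied to `T`, yields eigenvectors. The first
entry of an eigenvector of the companion matrix conjugates `y` to a root of `φ`. -/

open Polynomial
open scoped TensorProduct IsMulCommutative

/-! ### Characteristic polynomials of extensions and powers -/

section CharpolyExtension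

variable {R V : Type*} [CommRing R] [AddCommGroup V]
    [Module R V] [Module.Finite R V] [Module.Free R V]

open Module Module.Basis in
/-- The characteristic polynomial is multiplicative along an invariant submodule. -/
theorem LinearMap.charpoly_eq_charpoly_mul_charpoly
    (W : Submodule R V) [Module.Free R W] [Module.Finite R W] [Module.Free R (V ⧸ W)]
    (e : V →ₗ[R] V) (he : W ≤ W.comap e) :
    e.charpoly = (e.restrict he).charpoly * (W.mapQ W e he).charpoly := by
  classical
  let m := Module.Free.ChooseBasisIndex R W
  let bW : Basis m R W := Module.Free.chooseBasis R W
  let n := Module.Free.ChooseBasisIndex R (V ⧸ W)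
  let bQ : Basis n R (V ⧸ W) := Module.Free.chooseBasis R (V ⧸ W)
  let b := sumQuot bW bQ
  let A : Matrix m m R := LinearMap.toMatrix bW bW (e.restrict he)
  let B : Matrix m n R := Matrix.of fun i l ↦
    ((sumQuot bW bQ).repr (e ((sumQuot bW bQ) (Sum.inr l)))) (Sum.inl i)
  let D : Matrix n n R := LinearMap.toMatrix bQ bQ (W.mapQ W e he)
  suffices LinearMap.toMatrix b b e = Matrix.fromBlocks A B 0 D by
    rw [← LinearMap.charpoly_toMatrix e b, this, ← LinearMap.charpoly_toMatrix _ bW,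
      ← LinearMap.charpoly_toMatrix _ bQ, Matrix.charpoly_fromBlocks_zero₂₁]
  ext u v
  cases u with
  | inl i =>
    cases v with
    | inl k =>
      simp only [b, sumQuot_inl, Matrix.fromBlocks_apply₁₁, A, LinearMap.toMatrix_apply]
      apply sumQuot_repr_inl_of_mem
    | inr l => simp [b, LinearMap.toMatrix_apply, Matrix.fromBlocks_apply₁₂, B]
  | inr j =>
    cases v with
    | inl k =>
      suffices W.mkQ (e (bW k)) = 0 by simp [LinearMap.toMatrix_apply, b, this]
      rw [← LinearMap.mem_ker, Submodule.ker_mkQ]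
      exact he (Submodule.coe_mem (bW k))
    | inr l =>
      simp only [LinearMap.toMatrix_apply, sumQuot_repr_inr,
        Matrix.fromBlocks_apply₂₂, b, D]
      rw [← sumQuot_inr bW bQ l, W.mapQ_apply]
      simp

/-- An endomorphism acting diagonally on `V ^ k`. -/
theorem LinearMap.charpoly_compLeft_fin (f : V →ₗ[R] V) (k : ℕ) :
    (f.compLeft (Fin k)).charpoly = f.charpoly ^ k := by
  nontriviality R
  induction k with
  | zero =>
    rw [pow_zero]
    exact (f.compLeft (Fin 0)).charpoly_monic.natDegree_eq_zero.mp
      (by rw [LinearMap.charpoly_natDegree]; exact Module.finrank_zero_of_subsingleton)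
  | succ k ih =>
    have h : (f.compLeft (Fin (k + 1))) =
        (Fin.consLinearEquiv R (fun _ : Fin (k + 1) => V)).conj
          (f.prodMap (f.compLeft (Fin k))) := by
      refine LinearMap.ext fun v => funext fun i => ?_
      rw [LinearEquiv.conj_apply]
      refine Fin.cases ?_ (fun j => ?_) i <;> simp [Fin.consLinearEquiv, Fin.tail, Fin.consEquiv]
    rw [h, LinearEquiv.charpoly_conj, LinearMap.charpoly_prodMap, ih, pow_succ']

theorem LinearMap.charpoly_compLeft {ι : Type*} [Fintype ι] (f : V →ₗ[R] V) :
    (f.compLeft ι).charpoly = f.charpoly ^ Fintype.card ι := by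
  rw [← LinearMap.charpoly_compLeft_fin,
    ← LinearEquiv.charpoly_conj (LinearEquiv.funCongrLeft R V (Fintype.equivFin ι))
      (f.compLeft (Fin _))]
  congr 1
  ext v i
  simp [LinearEquiv.conj_apply, LinearMap.funLeft]

end CharpolyExtension

/-! ### Linear independence over a central division algebra; splitting -/

section CentralIndependence

variable {F E : Type*} [Field F] [DivisionRing E] [Algebra F E] [Algebra.IsCentral F E]

/-- Over a central division algebra `E`, endomorphisms of an `E`-module that are linearly
independent over `F` are linearly independent over `E` as maps. -/
theorem eq_zero_of_sum_smul_end_eq_zero {W ι : Type*} [AddCommGroup W] [Module F W] [Module E W]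
    [IsScalarTower F E W] {t : ι → Module.End E W} (ht : LinearIndependent F t)
    (s : Finset ι) (a : ι → E) (h : ∀ w, ∑ i ∈ s, a i • t i w = 0) : ∀ i ∈ s, a i = 0 := by
  classical
  induction s using Finset.induction_on generalizing a with
  | empty => simp
  | insert j s hj ih =>
    have key : a j = 0 := by
      by_contra hne
      set c : ι → E := fun i => (a j)⁻¹ * a i with hc
      have hcj : c j = 1 := inv_mul_cancel₀ hne
      have hsum : ∀ w, ∑ i ∈ insert j s, c i • t i w = 0 := fun w => by
        simp only [hc, mul_smul, ← Finset.smul_sum, h, smul_zero]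
      -- The relation at `b • w` minus `b` times the relation at `w` loses its `j`-term, since `c j
      -- = 1`. So the shorter relation has zero coefficients, and every `c i` is central.
      have hcomm : ∀ i ∈ s, ∀ b : E, c i * b - b * c i = 0 := by
        intro i hi b
        refine ih (fun i => c i * b - b * c i) (fun w => ?_) i hi
        have h1 := hsum (b • w)
        have h2 := congrArg (b • ·) (hsum w)
        simp only [Finset.sum_insert hj, hcj, map_smul, one_smul, smul_add, smul_zero,
          Finset.smul_sum, smul_smul] at h1 h2
        have := sub_eq_zero.mpr (h1.trans h2.symm)
        rw [one_mul, add_sub_add_left_eq_sub, ← Finset.sum_sub_distrib] at this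
        simpa only [sub_smul] using this
      have hcent : ∀ i ∈ insert j s, ∃ r : F, algebraMap F E r = c i := by
        intro i hi
        have : c i ∈ Subalgebra.center F E := by
          rw [Subalgebra.mem_center_iff]
          intro b
          rcases Finset.mem_insert.mp hi with rfl | hi
          · simp [hcj]
          · exact (sub_eq_zero.mp (hcomm i hi b)).symm
        rw [Algebra.IsCentral.center_eq_bot, Algebra.mem_bot] at this
        exact this
      choose! r hr using hcent
      have := linearIndependent_iff'.mp ht (insert j s) r (by
        ext w
        simp only [LinearMap.sum_apply, LinearMap.smul_apply, LinearMap.zero_apply]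
        rw [← hsum w]
        exact Finset.sum_congr rfl fun i hi => by rw [← hr i hi, algebraMap_smul])
        j (Finset.mem_insert_self _ _)
      have h1 := hr j (Finset.mem_insert_self _ _)
      rw [this, map_zero, hcj] at h1
      exact zero_ne_one h1
    intro i hi
    rcases Finset.mem_insert.mp hi with rfl | hi
    · exact key
    · exact ih a (fun w => by simpa [Finset.sum_insert hj, key] using h w) i hi

/-- Nonzero modules over `L ⊗ E` are faithful. -/
theorem eq_zero_of_smul_eq_zero_of_tensor {L : Type*} [Field L] [Algebra F L] {W : Type*}
    [AddCommGroup W] [Module (L ⊗[F] E) W] [Nontrivial W] (x : L ⊗[F] E)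
    (hx : ∀ w : W, x • w = 0) : x = 0 := by
  let mE : Module E W := Module.compHom W
    (Algebra.TensorProduct.includeRight : E →ₐ[F] L ⊗[F] E).toRingHom
  let mF : Module F W := Module.compHom W (algebraMap F (L ⊗[F] E))
  have hE : ∀ (a : E) (w : W), a • w = ((1 : L) ⊗ₜ[F] a : L ⊗[F] E) • w := fun _ _ => rfl
  have hF : ∀ (a : F) (w : W), a • w = (algebraMap F (L ⊗[F] E) a) • w := fun _ _ => rfl
  have : IsScalarTower F E W := ⟨fun r a w => by
    rw [hE, hE, hF, smul_smul, TensorProduct.tmul_smul, Algebra.smul_def]⟩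
  let b := Module.Basis.ofVectorSpace F L
  let t : L →ₗ[F] Module.End E W :=
    { toFun := fun l =>
        { toFun := fun w => (l ⊗ₜ[F] (1 : E)) • w
          map_add' := fun _ _ => smul_add _ _ _
          map_smul' := fun a w => by simp [hE, smul_smul] }
      map_add' := fun l m => by ext w; simp [TensorProduct.add_tmul, add_smul]
      map_smul' := fun r l => by
        ext w
        simp [hF, smul_smul, Algebra.TensorProduct.algebraMap_apply, Algebra.smul_def] }
  have htinj : Function.Injective t := by
    rw [injective_iff_map_eq_zero]
    intro l hl
    by_contra hne
    obtain ⟨w, hw⟩ := exists_ne (0 : W)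
    apply hw
    have h1 : (l ⊗ₜ[F] (1 : E)) • w = 0 := LinearMap.congr_fun hl w
    have h2 := congrArg ((l⁻¹ ⊗ₜ[F] (1 : E)) • ·) h1
    simpa [smul_smul, inv_mul_cancel₀ hne, ← Algebra.TensorProduct.one_def] using h2
  have ht : LinearIndependent F (t ∘ b) :=
    b.linearIndependent.map' t (LinearMap.ker_eq_bot.mpr htinj)
  obtain ⟨c, rfl⟩ := TensorProduct.eq_repr_basis_left b x
  have := eq_zero_of_sum_smul_end_eq_zero ht c.support c (fun w => by
    rw [← hx w, Finsupp.sum, Finset.sum_smul]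
    refine Finset.sum_congr rfl fun i _ => ?_
    simp [t, hE, smul_smul])
  exact Finset.sum_eq_zero fun i hi => by simp [this i hi]

/-- A proper two-sided ideal kills its own nonzero quotient module, which is faithful. -/
instance isSimpleRing_tensor (L : Type*) [Field L] [Algebra F L] : IsSimpleRing (L ⊗[F] E) := by
  refine isSimpleRing_iff_isTwoSided_imp.mpr ⟨inferInstance, fun I _ => ?_⟩
  rw [or_iff_not_imp_right]
  intro hI
  have : Nontrivial ((L ⊗[F] E) ⧸ I) := Submodule.Quotient.nontrivial_iff.mpr hI
  rw [eq_bot_iff]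
  intro x hx
  refine eq_zero_of_smul_eq_zero_of_tensor (W := (L ⊗[F] E) ⧸ I) x fun w => ?_
  obtain ⟨y, rfl⟩ := Submodule.Quotient.mk_surjective I w
  rw [← Submodule.Quotient.mk_smul, Submodule.Quotient.mk_eq_zero]
  exact Ideal.mul_mem_right y I hx

/-- An algebraically closed extension splits a central division algebra. -/
theorem exists_algEquiv_matrix_degree [FiniteDimensional F E] (L : Type*) [Field L] [Algebra F L]
    [IsAlgClosed L] :
    Nonempty (L ⊗[F] E ≃ₐ[L]
      Matrix (Fin (CentralDivision.degree F E)) (Fin (CentralDivision.degree F E)) L) := by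
  obtain ⟨n, _, ⟨e⟩⟩ := IsSimpleRing.exists_algEquiv_matrix_of_isAlgClosed L (L ⊗[F] E)
  have h := e.toLinearEquiv.finrank_eq
  rw [Module.finrank_baseChange, Module.finrank_matrix] at h
  have : CentralDivision.degree F E = n := by
    rw [CentralDivision.degree, h]; simp
  rw [this]
  exact ⟨e⟩

end CentralIndependence

/-! ### Representations of matrix algebras -/

section MatrixModules

/-- A representation of `M_d(k)` has dimension divisible by `d`. -/
theorem dvd_finrank_of_matrix_algHom {k V : Type*} [Field k] [AddCommGroup V] [Module k V]
    [FiniteDimensional k V] {d : ℕ} (ρ : Matrix (Fin d) (Fin d) k →ₐ[k] Module.End k V) :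
    d ∣ Module.finrank k V := by
  classical
  cases d with
  | zero =>
    have h : (1 : Module.End k V) = 0 := by
      rw [← map_one ρ, Subsingleton.elim (1 : Matrix (Fin 0) (Fin 0) k) 0, map_zero]
    have : Subsingleton V := ⟨fun x y => by
      have hz : ∀ z : V, z = 0 := fun z => LinearMap.congr_fun h z
      rw [hz x, hz y]⟩
    rw [Module.finrank_zero_of_subsingleton]
  | succ d =>
    have hmul : ∀ i j k' l v, ρ (Matrix.single i j 1) (ρ (Matrix.single k' l 1) v) =
        if j = k' then ρ (Matrix.single i l 1) v else 0 := by
      intro i j k' l v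
      rw [← Module.End.mul_apply, ← map_mul]
      split_ifs with h
      · subst h; simp
      · rw [Matrix.single_mul_single_of_ne _ _ _ _ h, map_zero, LinearMap.zero_apply]
    -- The matrix units carry the image of `e₀₀` onto each of the `d + 1` summands `e_ii V`, so `V`
    -- is `d + 1` copies of `N`.
    let N : Submodule k V := LinearMap.range (ρ (Matrix.single 0 0 1))
    have hN : ∀ x ∈ N, ρ (Matrix.single 0 0 1) x = x := by
      rintro _ ⟨y, rfl⟩
      rw [hmul, if_pos rfl]
    let e : V ≃ₗ[k] (Fin (d + 1) → N) :=
      { toFun := fun v i => ⟨ρ (Matrix.single 0 i 1) v, ρ (Matrix.single 0 i 1) v, by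
          rw [hmul, if_pos rfl]⟩
        map_add' := fun v w => by ext; simp
        map_smul' := fun c v => by ext; simp
        invFun := fun x => ∑ i, ρ (Matrix.single i 0 1) (x i : V)
        left_inv := fun v => by
          simp only [hmul, if_true]
          rw [← LinearMap.sum_apply, ← map_sum]
          have : ∑ i : Fin (d + 1), Matrix.single i i (1 : k) = 1 := by
            ext i j
            rw [Matrix.sum_apply, Matrix.one_apply, Finset.sum_eq_single i
              (fun l _ hl => by simp [hl]) (by simp), Matrix.single_apply]
            simp
          rw [this, map_one, Module.End.one_apply]
        right_inv := fun x => by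
          ext i
          simp only [map_sum, hmul]
          rw [Finset.sum_ite_eq Finset.univ i, if_pos (Finset.mem_univ i)]
          exact hN _ (x i).2 }
    rw [e.finrank_eq, Module.finrank_pi_fintype]
    simp

end MatrixModules

/-! ### Divisibility of dimensions by the degree -/

section DegreeDivides

variable {F E : Type*} [Field F] [DivisionRing E] [Algebra F E] [Algebra.IsCentral F E]
  [FiniteDimensional F E]

/-- Extending scalars from `L` to its algebraic closure keeps the dimension and turns the action of
`E` into a representation of a matrix algebra of size `degree F E`. -/
theorem degree_dvd_finrank {L W : Type*} [Field L] [Algebra F L] [AddCommGroup W] [Module F W]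
    [Module L W] [Module E W] [IsScalarTower F L W] [IsScalarTower F E W] [SMulCommClass E L W]
    [FiniteDimensional L W] :
    CentralDivision.degree F E ∣ Module.finrank L W := by
  let Ω := AlgebraicClosure L
  obtain ⟨e⟩ := exists_algEquiv_matrix_degree (F := F) (E := E) Ω
  let f : E →ₐ[F] Module.End Ω (Ω ⊗[L] W) :=
    ((Module.End.baseChangeHom L Ω W).restrictScalars F).comp (Algebra.lsmul F L W)
  let ρ : Ω ⊗[F] E →ₐ[Ω] Module.End Ω (Ω ⊗[L] W) :=
    Algebra.TensorProduct.lift (Algebra.ofId _ _) f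
      (fun x y => Algebra.commutes x (f y))
  have := dvd_finrank_of_matrix_algHom (ρ.comp e.symm.toAlgHom)
  rwa [Module.finrank_baseChange] at this

end DegreeDivides

/-! ### Kernels of polynomials in an operator -/

section Kernel

/-- Intertwining two operators intertwines their polynomials. -/
theorem map_aeval_apply_of_intertwine {F E₁ E₂ V₁ V₂ : Type*} [CommRing F] [Ring E₁] [Ring E₂]
    [Algebra F E₁] [Algebra F E₂] [AddCommGroup V₁] [AddCommGroup V₂] [Module F V₁] [Module F V₂]
    [Module E₁ V₁] [Module E₂ V₂] [IsScalarTower F E₁ V₁] [IsScalarTower F E₂ V₂]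
    (T₁ : Module.End E₁ V₁) (T₂ : Module.End E₂ V₂) (g : V₁ →ₗ[F] V₂)
    (hg : ∀ v, g (T₁ v) = T₂ (g v)) (q : F[X]) (v : V₁) :
    g (aeval T₁ q v) = aeval T₂ q (g v) := by
  induction q using Polynomial.induction_on' with
  | add q r hq hr => simp [hq, hr]
  | monomial m a =>
    have : ∀ v, g ((T₁ ^ m) v) = (T₂ ^ m) (g v) := by
      induction m with
      | zero => simp
      | succ m ih => intro v; rw [pow_succ, pow_succ, Module.End.mul_apply, Module.End.mul_apply,
          ih, hg]
    simp [aeval_monomial, Module.algebraMap_end_apply, this]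

/-- A root of `p` in the algebraic closure is an eigenvalue of the base change of `T`, so `p(T)` is
not injective there; by flatness it is not injective over `F` either. -/
theorem exists_ne_zero_aeval_apply_eq_zero {F V : Type*} [Field F] [AddCommGroup V] [Module F V]
    [FiniteDimensional F V] (T : Module.End F V) {p : F[X]} (hp : p.degree ≠ 0)
    (hdvd : p ∣ T.charpoly) : ∃ v ≠ 0, aeval T p v = 0 := by
  let Ω := AlgebraicClosure F
  obtain ⟨α, hα⟩ := IsAlgClosed.exists_root (p.map (algebraMap F Ω)) (by rwa [degree_map])
  have hroot : (LinearMap.baseChange Ω T).charpoly.IsRoot α := by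
    rw [LinearMap.charpoly_baseChange]
    exact hα.dvd (Polynomial.map_dvd _ hdvd)
  obtain ⟨w, hw⟩ := (Module.End.HasEigenvalue.exists_hasEigenvector
    ((Module.End.hasEigenvalue_iff_isRoot_charpoly _ _).mpr hroot))
  have h1 := Module.End.aeval_apply_of_hasEigenvector (p := p.map (algebraMap F Ω)) hw
  rw [hα.eq_zero, zero_smul, aeval_map_algebraMap] at h1
  have h2 : aeval (LinearMap.baseChange Ω T) p = LinearMap.baseChange Ω (aeval T p) :=
    (Polynomial.aeval_algHom_apply (Module.End.baseChangeHom F Ω V) T p)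
  rw [h2] at h1
  by_contra! hne
  have hinj : Function.Injective (aeval T p) := by
    rw [injective_iff_map_eq_zero]
    intro v hv
    by_contra h
    exact hne v h hv
  exact hw.2 (Module.Flat.lTensor_preserves_injective_linearMap (M := Ω) _ hinj
    (h1.trans (map_zero _).symm))

end Kernel

/-! ### The characteristic polynomial over the center as a power -/

section CharpolyPower

variable {F E : Type*} [Field F] [DivisionRing E] [Algebra F E] [Algebra.IsCentral F E]
  [FiniteDimensional F E]

/-- An endomorphism annihilated by an irreducible polynomial `p` makes the space a vector space
over `F[X] / p`. -/
theorem exists_charpoly_eq_pow_of_aeval_eq_zero {W : Type*} [AddCommGroup W] [Module F W]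
    [Module E W] [IsScalarTower F E W] [FiniteDimensional F W] (T : Module.End E W) {p : F[X]}
    (hp : Irreducible p) (hm : p.Monic) (hT : aeval T p = 0) :
    ∃ k : ℕ, (T.restrictScalars F).charpoly = (p ^ k) ^ CentralDivision.degree F E := by
  have := Fact.mk hp
  let L := AdjoinRoot p
  let φ : L →+* Module.End E W := Ideal.Quotient.lift (Ideal.span {p})
    (aeval T : F[X] →ₐ[F] Module.End E W).toRingHom (fun a ha => by
      obtain ⟨b, rfl⟩ := Ideal.mem_span_singleton.mp ha
      simp [hT])
  let mL : Module L W := Module.compHom W φ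
  have hφ : ∀ q : F[X], φ (AdjoinRoot.mk p q) = aeval T q := fun q => rfl
  have hL : ∀ (l : L) (w : W), l • w = φ l w := fun _ _ => rfl
  have : IsScalarTower F L W := ⟨fun r l w => by
    obtain ⟨q, rfl⟩ := AdjoinRoot.mk_surjective l
    rw [AdjoinRoot.smul_mk, hL, hL, hφ, hφ, map_smul, LinearMap.smul_apply]⟩
  have : SMulCommClass E L W := ⟨fun a l w => by
    rw [hL, hL, map_smul]⟩
  have : FiniteDimensional L W := Module.Finite.of_restrictScalars_finite F L W
  obtain ⟨k, hk⟩ := degree_dvd_finrank (F := F) (E := E) (L := L) (W := W)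
  let b := Module.finBasis L W
  let pb := AdjoinRoot.powerBasis' hm
  have : Module.Finite F L := pb.finite
  let e : W ≃ₗ[F] (Fin (Module.finrank L W) → L) := b.equivFun.restrictScalars F
  have hlmul : (Algebra.lmul F L (AdjoinRoot.root p)).charpoly = p := by
    rw [← LinearMap.charpoly_toMatrix _ pb.basis]
    have := charpoly_leftMulMatrix pb
    rw [AdjoinRoot.powerBasis'_gen, AdjoinRoot.minpoly_root hp.ne_zero, hm.leadingCoeff] at this
    rwa [inv_one, C_1, mul_one] at this
  -- In `L`-coordinates `T` multiplies each entry by the root of `p`, and that multiplication has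
  -- characteristic polynomial `p`.
  have hconj : e.conj (T.restrictScalars F) =
      (Algebra.lmul F L (AdjoinRoot.root p)).compLeft (Fin (Module.finrank L W)) := by
    refine LinearMap.ext fun x => ?_
    rw [LinearEquiv.conj_apply]
    obtain ⟨w, rfl⟩ := e.surjective x
    have : T w = (AdjoinRoot.root p) • w := by
      rw [hL, ← AdjoinRoot.mk_X, hφ, aeval_X]
    simp only [LinearMap.comp_apply, LinearEquiv.coe_coe, LinearEquiv.symm_apply_apply,
      LinearMap.restrictScalars_apply, this]
    ext i
    simp [e]
  refine ⟨k, ?_⟩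
  rw [← LinearEquiv.charpoly_conj e, hconj, LinearMap.charpoly_compLeft, hlmul, Fintype.card_fin, hk,
    mul_comm, pow_mul]

omit [Algebra.IsCentral F E] [FiniteDimensional F E] in
theorem charpoly_restrictScalars_eq_mul {W : Type*} [AddCommGroup W] [Module F W]
    [Module E W] [IsScalarTower F E W] [FiniteDimensional F W] (T : Module.End E W)
    (U : Submodule E W) (hU : U ≤ U.comap T) :
    have : FiniteDimensional F U := inferInstanceAs (FiniteDimensional F (U.restrictScalars F))
    (T.restrictScalars F).charpoly = ((T.restrict hU).restrictScalars F).charpoly *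
      ((U.mapQ U T hU).restrictScalars F).charpoly := by
  intro _
  rw [LinearMap.charpoly_eq_charpoly_mul_charpoly (U.restrictScalars F) (T.restrictScalars F) hU]
  congr 1

/-- Over a central division algebra of degree `d`, the characteristic polynomial over the center
is a `d`-th power. -/
theorem exists_monic_charpoly_eq_pow_degree {W : Type*} [AddCommGroup W] [Module F W]
    [Module E W] [IsScalarTower F E W] [FiniteDimensional F W] (T : Module.End E W) :
    ∃ Q : F[X], Q.Monic ∧ (T.restrictScalars F).charpoly = Q ^ CentralDivision.degree F E := by
  induction h : Module.finrank F W using Nat.strong_induction_on generalizing W with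
  | _ n ih =>
    have hnat : (T.restrictScalars F).charpoly.natDegree = n := by
      rw [LinearMap.charpoly_natDegree, h]
    have hmon := (T.restrictScalars F).charpoly_monic
    by_cases hn : n = 0
    · refine ⟨1, monic_one, ?_⟩
      rw [one_pow, ← hmon.natDegree_eq_zero, hnat, hn]
    · obtain ⟨p, hm, hp, hdvd⟩ := Polynomial.exists_monic_irreducible_factor
        (T.restrictScalars F).charpoly (fun hu => hn (by
          rw [← hnat]; exact natDegree_eq_zero_of_isUnit hu))
      obtain ⟨v, hv, hpv⟩ := exists_ne_zero_aeval_apply_eq_zero (T.restrictScalars F)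
        (fun h0 => hp.natDegree_pos.ne' (natDegree_eq_of_degree_eq_some h0)) hdvd
      have hres : ∀ (q : F[X]) (w : W), aeval (T.restrictScalars F) q w = aeval T q w :=
        fun q w => map_aeval_apply_of_intertwine (T.restrictScalars F) T LinearMap.id (fun _ => rfl) q w
      -- The coefficients of `p` are central, so `p(T)` is `E`-linear and its kernel is an
      -- `E`-subspace.
      let U : Submodule E W := LinearMap.ker (aeval T p)
      have hU : U ≤ U.comap T := fun w hw =>
        (map_aeval_apply_of_intertwine T T (T.restrictScalars F) (fun _ => rfl) p w).symm.trans
          ((congrArg T hw).trans (map_zero T))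
      have hU0 : U ≠ ⊥ := fun h0 => hv (by
        have : v ∈ U := by rw [LinearMap.mem_ker, ← hres, hpv]
        rwa [h0, Submodule.mem_bot] at this)
      have : FiniteDimensional F U := inferInstanceAs (FiniteDimensional F (U.restrictScalars F))
      have hann : aeval (T.restrict (p := U) (q := U) hU) p = 0 := by
        have : ∀ (q : F[X]) (w : U), ((aeval (T.restrict (p := U) (q := U) hU) q w : U) : W) =
            aeval T q w :=
          fun q w => map_aeval_apply_of_intertwine (T.restrict (p := U) (q := U) hU) T
            (U.subtype.restrictScalars F) (fun _ => rfl) q w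
        refine LinearMap.ext fun w => Subtype.ext ?_
        rw [this]
        exact w.2
      obtain ⟨k, hk⟩ := exists_charpoly_eq_pow_of_aeval_eq_zero (F := F)
        (T.restrict (p := U) (q := U) hU) hp hm hann
      have hlt : Module.finrank F (W ⧸ U) < n := by
        have h1 := Submodule.finrank_quotient_add_finrank (U.restrictScalars F)
        have h2 : 0 < Module.finrank F (U.restrictScalars F) := by
          have : Nontrivial (U.restrictScalars F) := Submodule.nontrivial_iff_ne_bot (p := U) |>.mpr hU0
          exact Module.finrank_pos
        have h3 := (Submodule.Quotient.restrictScalarsEquiv F U).finrank_eq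
        omega
      obtain ⟨Q, hQ, hQ'⟩ := ih _ hlt (U.mapQ U T hU) rfl
      exact ⟨p ^ k * Q, (hm.pow k).mul hQ, by
        rw [charpoly_restrictScalars_eq_mul T U hU, hk, hQ', mul_pow]⟩

end CharpolyPower

/-! ### Self-centralizing subfields -/

section SelfCentralizing

variable {F D L : Type*} [Field F] [DivisionRing D] [Algebra F D] [Algebra.IsCentral F D]
  [FiniteDimensional F D] [Field L] [Algebra F L]

/-- A self-centralizing subfield `L` of `D` satisfies `[D : F] = [D : L] ^ 2`. -/
theorem finrank_eq_sq_of_selfCentralizing [Module L D] [IsScalarTower F L D] (j : L →ₐ[F] D)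
    (hj : ∀ (l : L) (x : D), l • x = x * j l)
    (hc : ∀ x : D, (∀ l, x * j l = j l * x) → ∃ l, j l = x) :
    Module.finrank F D = Module.finrank L D ^ 2 := by
  have hcomm : SMulCommClass D L D := ⟨fun a l x => by simp only [hj, smul_eq_mul, mul_assoc]⟩
  have hLfin : FiniteDimensional F L :=
    FiniteDimensional.of_injective j.toLinearMap j.toRingHom.injective
  have hDfin : FiniteDimensional L D := Module.Finite.of_restrictScalars_finite F L D
  -- `D` acts on itself from the left and `L` from the right. `Θ` is injective because `L ⊗ D` is
  -- simple, and onto by Jacobson density; comparing dimensions gives the formula.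
  let Θ : L ⊗[F] D →ₐ[F] Module.End L D :=
    Algebra.TensorProduct.lift (Algebra.lsmul F L D) (Algebra.lsmul F L D) (fun l a => by
      ext x
      simp)
  have hΘ : ∀ l a x, Θ (l ⊗ₜ a) x = a * x * j l := by
    intro l a x
    exact (DFunLike.congr_fun (Algebra.TensorProduct.lift_tmul (Algebra.lsmul F L D)
      (Algebra.lsmul F L D) _ l a) x).trans (hj l (a * x))
  let _ : Module (L ⊗[F] D) D := Module.compHom D Θ.toRingHom
  have hsmul : ∀ (r : L ⊗[F] D) (x : D), r • x = Θ r x := fun _ _ => rfl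
  have hsimple : IsSimpleModule (L ⊗[F] D) D := by
    refine { exists_pair_ne := ⟨⊥, ⊤, bot_ne_top⟩, eq_bot_or_eq_top := fun N => ?_ }
    rw [or_iff_not_imp_left]
    intro hN
    obtain ⟨x, hx, hx0⟩ := (Submodule.ne_bot_iff N).mp hN
    rw [eq_top_iff]
    intro y _
    have := N.smul_mem ((1 : L) ⊗ₜ[F] (y * x⁻¹)) hx
    rwa [hsmul, hΘ, map_one, mul_one, inv_mul_cancel_right₀ hx0] at this
  -- Commuting with left multiplications makes `c` right multiplication by `c 1`; commuting with `L`
  -- puts `c 1` in the centralizer of `L`, which is `L`.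
  have hend : ∀ c : Module.End (L ⊗[F] D) D, ∃ l : L, ∀ x, c x = l • x := by
    intro c
    have h1 : ∀ x, c x = x * c 1 := fun x => by
      have := c.map_smul ((1 : L) ⊗ₜ[F] x) 1
      simpa [hsmul, hΘ] using this
    obtain ⟨l, hl⟩ := hc (c 1) (fun l => by
      have := c.map_smul (l ⊗ₜ[F] (1 : D)) 1
      rw [hsmul, hsmul, hΘ, hΘ, one_mul, one_mul, one_mul, h1] at this
      exact this.symm)
    exact ⟨l, fun x => by rw [h1, hj, hl]⟩
  have hinj : Function.Injective Θ := RingHom.injective Θ.toRingHom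
  have hsurj : Function.Surjective Θ := by
    classical
    intro f
    let f' : Module.End (Module.End (L ⊗[F] D) D) D :=
      { toFun := f
        map_add' := map_add f
        map_smul' := fun c x => by
          obtain ⟨l, hl⟩ := hend c
          simp only [Module.End.smul_def, hl, map_smul, RingHom.id_apply] }
    let b := Module.finBasis L D
    obtain ⟨r, hr⟩ := jacobson_density (R := L ⊗[F] D) f' (Finset.univ.image b)
    refine ⟨r, b.ext fun i => ?_⟩
    exact (hr (b i) (Finset.mem_image_of_mem _ (Finset.mem_univ i))).symm
  have h := (LinearEquiv.ofBijective Θ.toLinearMap ⟨hinj, hsurj⟩).finrank_eq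
  rw [Module.finrank_tensorProduct, ← Module.finrank_mul_finrank F L (Module.End L D),
    Module.finrank_linearMap] at h
  rw [sq]
  exact Nat.eq_of_mul_eq_mul_left Module.finrank_pos h

theorem finrank_eq_degree_of_selfCentralizing [Module L D] [IsScalarTower F L D] (j : L →ₐ[F] D)
    (hj : ∀ (l : L) (x : D), l • x = x * j l)
    (hc : ∀ x : D, (∀ l, x * j l = j l * x) → ∃ l, j l = x) :
    Module.finrank L D = CentralDivision.degree F D := by
  rw [CentralDivision.degree, finrank_eq_sq_of_selfCentralizing j hj hc, Nat.sqrt_eq']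

/-- With `b` an `L`-basis of `D`, the map `l ⊗ v ↦ (v * b i * j l)_i` identifies `L ⊗ Dⁿ` with `[D :
L]` copies of `Dⁿ`. It carries the base change of `T` to `T'` on each copy, as `T` commutes with
right multiplications. -/
theorem charpoly_restrictScalars_pow_degree [Module L D] [IsScalarTower F L D] (j : L →ₐ[F] D)
    (hj : ∀ (l : L) (x : D), l • x = x * j l)
    (hc : ∀ x : D, (∀ l, x * j l = j l * x) → ∃ l, j l = x) [FiniteDimensional L D] {n : ℕ}
    (T : Module.End Dᵐᵒᵖ (Fin n → D)) (T' : Module.End L (Fin n → D)) (hT : ∀ v, T' v = T v) :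
    T'.charpoly ^ CentralDivision.degree F D =
      (T.restrictScalars F).charpoly.map (algebraMap F L) := by
  have hDL := finrank_eq_degree_of_selfCentralizing j hj hc
  have hDF := finrank_eq_sq_of_selfCentralizing j hj hc
  have hcomm : SMulCommClass D L D := ⟨fun a l x => by simp only [hj, smul_eq_mul, mul_assoc]⟩
  have hcomm' : SMulCommClass L D D := SMulCommClass.symm D L D
  let b := Module.finBasis L D
  let ψ : (Fin n → D) →ₗ[F] (Fin (Module.finrank L D) → Fin n → D) :=
    { toFun := fun v i => MulOpposite.op (b i) • v
      map_add' := fun v w => by ext; simp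
      map_smul' := fun r v => by ext; simp }
  let Ψ : L ⊗[F] (Fin n → D) →ₗ[L] (Fin (Module.finrank L D) → Fin n → D) :=
    TensorProduct.AlgebraTensorModule.lift
      ((LinearMap.toSpanSingleton L _ ψ))
  have hΨ : ∀ l v i k, Ψ (l ⊗ₜ v) i k = v k * b i * j l := by
    intro l v i k
    simp [Ψ, ψ, hj]
  have hinj : Function.Injective Ψ := by
    rw [injective_iff_map_eq_zero]
    intro x hx
    let c := Module.Basis.ofVectorSpace F L
    obtain ⟨a, rfl⟩ := TensorProduct.eq_repr_basis_left c x
    let t : L →ₗ[F] Module.End D D := (Algebra.lsmul F D D).toLinearMap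
    have ht : LinearIndependent F (t ∘ c) :=
      c.linearIndependent.map' t (LinearMap.ker_eq_bot.mpr (by
        rw [injective_iff_map_eq_zero]
        intro l hl
        have : l • (1 : D) = 0 := LinearMap.congr_fun hl 1
        rw [hj, one_mul] at this
        exact (map_eq_zero j).mp this))
    -- The `k`-th entries vanish on the basis `b`, hence on all of `D` by `L`-linearity. Right
    -- multiplications by the `j (c i)` are `F`-independent, hence independent over left
    -- `D`-coefficients.
    have hzero : ∀ (k : Fin n) (y : D), ∑ i ∈ a.support, a i k • (t ∘ c) i y = 0 := by
      intro k
      let Z : D →ₗ[L] D := ∑ i ∈ a.support, (a i k) • (Algebra.lsmul F L D (c i))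
      have hZ : Z = 0 := b.ext fun i => by
        have h1 := congrFun (congrFun hx i) k
        rw [Finsupp.sum, map_sum, Finset.sum_apply, Finset.sum_apply] at h1
        simp only [hΨ] at h1
        simpa [Z, hj, mul_assoc] using h1
      intro y
      simpa [Z, t] using LinearMap.congr_fun hZ y
    have := fun k => eq_zero_of_sum_smul_end_eq_zero ht a.support (fun i => a i k) (hzero k)
    refine Finset.sum_eq_zero fun i hi => ?_
    have : a i = 0 := funext fun k => this k i hi
    simp [this]
  have hdim : Module.finrank L (L ⊗[F] (Fin n → D)) =
      Module.finrank L (Fin (Module.finrank L D) → Fin n → D) := by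
    rw [Module.finrank_baseChange, Module.finrank_pi_fintype, Module.finrank_pi_fintype,
      Module.finrank_pi_fintype]
    simp [hDF]
    ring
  let e := LinearEquiv.ofInjectiveOfFinrankEq Ψ hinj hdim
  have hconj : e.conj ((T.restrictScalars F).baseChange L) =
      T'.compLeft (Fin (Module.finrank L D)) := by
    refine LinearMap.ext fun x => ?_
    obtain ⟨w, rfl⟩ := e.surjective x
    rw [LinearEquiv.conj_apply]
    simp only [LinearMap.comp_apply, LinearEquiv.coe_coe, LinearEquiv.symm_apply_apply]
    induction w using TensorProduct.induction_on with
    | zero => simp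
    | add x y hx hy => simp only [map_add, hx, hy]
    | tmul l v =>
      have h1 : ∀ x, e x = Ψ x := fun _ => rfl
      have h2 : ∀ l v i, Ψ (l ⊗ₜ v) i = MulOpposite.op (b i * j l) • v := fun l v i => by
        ext k
        rw [hΨ]
        simp [mul_assoc]
      ext i k
      rw [LinearMap.baseChange_tmul, h1, h1, h2, LinearMap.compLeft_apply, Function.comp_apply, h2, hT,
        map_smul]
      rfl
  have := LinearEquiv.charpoly_conj e ((T.restrictScalars F).baseChange L)
  rw [hconj, LinearMap.charpoly_compLeft, Fintype.card_fin, hDL, LinearMap.charpoly_baseChange] at this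
  exact this

end SelfCentralizing

/-! ### The reduced characteristic polynomial -/

section ReducedCharpoly

variable {F D : Type*} [Field F] [DivisionRing D] [Algebra F D] [Algebra.IsCentral F D]
  [FiniteDimensional F D]

variable (F D) in
-- `degree` is a rounded-down square root; splitting over the algebraic closure shows that nothing
-- is lost.
theorem finrank_eq_degree_sq : Module.finrank F D = CentralDivision.degree F D ^ 2 := by
  obtain ⟨e⟩ := exists_algEquiv_matrix_degree (F := F) (E := D) (AlgebraicClosure F)
  have h := e.toLinearEquiv.finrank_eq
  rw [Module.finrank_baseChange, Module.finrank_matrix] at h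
  simpa [sq] using h

variable (F D) in
theorem degree_pos : 0 < CentralDivision.degree F D := by
  have h : 0 < Module.finrank F D := Module.finrank_pos
  rw [finrank_eq_degree_sq] at h
  exact Nat.pos_of_ne_zero fun h0 => by simp [h0] at h

variable (F) in
omit [Algebra.IsCentral F D] [FiniteDimensional F D] in
theorem finrank_mulOpposite : Module.finrank F Dᵐᵒᵖ = Module.finrank F D :=
  (MulOpposite.opLinearEquiv F).finrank_eq.symm

/-- The characteristic polynomial over the center of a matrix over `D`, acting on columns, is the
power with exponent `degree F D` of its reduced characteristic polynomial. -/
theorem exists_monic_charpoly_mulVec_eq_pow (n : ℕ) (A : Matrix (Fin n) (Fin n) D) :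
    ∃ Q : F[X], Q.Monic ∧ Q.natDegree = n * CentralDivision.degree F D ∧
      ((Matrix.mulVecBilin D Dᵐᵒᵖ A).restrictScalars F).charpoly =
        Q ^ CentralDivision.degree F D := by
  have : FiniteDimensional F Dᵐᵒᵖ := Module.Finite.equiv (MulOpposite.opLinearEquiv F)
  obtain ⟨Q, hQ, h⟩ := exists_monic_charpoly_eq_pow_degree (F := F) (Matrix.mulVecBilin D Dᵐᵒᵖ A)
  have hdeg : CentralDivision.degree F Dᵐᵒᵖ = CentralDivision.degree F D := by
    rw [CentralDivision.degree, CentralDivision.degree, finrank_mulOpposite]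
  rw [hdeg] at h
  refine ⟨Q, hQ, ?_, h⟩
  have h1 := congrArg natDegree h
  rw [LinearMap.charpoly_natDegree, natDegree_pow, Module.finrank_pi_fintype] at h1
  simp only [finrank_eq_degree_sq F D, Finset.sum_const, Finset.card_univ, Fintype.card_fin,
    smul_eq_mul] at h1
  refine Nat.eq_of_mul_eq_mul_left (degree_pos F D) ?_
  rw [← h1]
  ring

/-- By unique factorization, divisibility of `d`-th powers descends to the bases, in any
characteristic. -/
theorem eq_of_pow_eq_pow_of_monic {L : Type*} [Field L] {p q : L[X]} (hp : p.Monic) (hq : q.Monic)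
    {d : ℕ} (hd : d ≠ 0) (h : p ^ d = q ^ d) : p = q :=
  eq_of_monic_of_associated hp hq <| associated_of_dvd_dvd
    ((UniqueFactorizationMonoid.pow_dvd_pow_iff_dvd hd).mp h.dvd)
    ((UniqueFactorizationMonoid.pow_dvd_pow_iff_dvd hd).mp h.symm.dvd)

variable {L : Type*} [Field L] [Algebra F L]

/-- The right vector space structure of `D` over a subfield. -/
abbrev rightModule (j : L →ₐ[F] D) : Module L D where
  smul l x := x * j l
  one_smul x := by change x * j 1 = x; simp
  mul_smul l l' x := by
    change x * j (l * l') = x * j l' * j l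
    rw [mul_comm l, map_mul, mul_assoc]
  smul_zero _ := zero_mul _
  smul_add _ _ _ := add_mul _ _ _
  add_smul l l' x := by
    change x * j (l + l') = x * j l + x * j l'
    rw [map_add, mul_add]
  zero_smul x := by change x * j 0 = 0; simp

theorem charpoly_of_rightIso (j : L →ₐ[F] D)
    (hc : ∀ x : D, (∀ l, x * j l = j l * x) → ∃ l, j l = x) {n m : ℕ}
    (A : Matrix (Fin n) (Fin n) D) (g : (Fin n → D) ≃+ (Fin m → L))
    (hg : ∀ (v : Fin n → D) (l : L), g (fun i => v i * j l) = fun i => g v i * l) {Q : F[X]}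
    (hQ : Q.Monic) (hA : ((Matrix.mulVecBilin D Dᵐᵒᵖ A).restrictScalars F).charpoly =
      Q ^ CentralDivision.degree F D) :
    (Matrix.of fun i k => g (A.mulVec (g.symm (Pi.single k 1))) i).charpoly =
      Q.map (algebraMap F L) := by
  let _ : Module L D := rightModule j
  have hj : ∀ (l : L) (x : D), l • x = x * j l := fun _ _ => rfl
  have : IsScalarTower F L D := ⟨fun r l x => by simp [hj]⟩
  have : FiniteDimensional L D := Module.Finite.of_restrictScalars_finite F L D
  let T : Module.End L (Fin n → D) :=
    { toFun := A.mulVec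
      map_add' := A.mulVec_add
      map_smul' := fun l v => by
        have h : ∀ w : Fin n → D, l • w = MulOpposite.op (j l) • w := fun w => rfl
        rw [RingHom.id_apply, h, h, Matrix.mulVec_smul] }
  have h := charpoly_restrictScalars_pow_degree j hj hc (Matrix.mulVecBilin D Dᵐᵒᵖ A) T
    (fun _ => rfl)
  rw [hA, Polynomial.map_pow] at h
  rw [← eq_of_pow_eq_pow_of_monic T.charpoly_monic (hQ.map _) (degree_pos F D).ne' h]
  let e : (Fin n → D) ≃ₗ[L] (Fin m → L) :=
    { g with
      map_smul' := fun l v => by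
        refine (hg v l).trans ?_
        ext i
        exact mul_comm _ _ }
  rw [← LinearEquiv.charpoly_conj e, ← LinearMap.charpoly_toMatrix _ (Pi.basisFun L (Fin m))]
  congr 1

omit [Algebra.IsCentral F D] in
theorem exists_rightIso (j : L →ₐ[F] D) (n : ℕ) : ∃ (m : ℕ) (g : (Fin n → D) ≃+ (Fin m → L)),
    ∀ (v : Fin n → D) (l : L), g (fun i => v i * j l) = fun i => g v i * l := by
  let _ : Module L D := rightModule j
  have hj : ∀ (l : L) (x : D), l • x = x * j l := fun _ _ => rfl
  have : IsScalarTower F L D := ⟨fun r l x => by simp [hj]⟩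
  have : FiniteDimensional L D := Module.Finite.of_restrictScalars_finite F L D
  refine ⟨_, (Module.finBasis L (Fin n → D)).equivFun.toAddEquiv, fun v l => ?_⟩
  refine ((Module.finBasis L (Fin n → D)).equivFun.map_smul l v).trans ?_
  ext i
  exact mul_comm _ _

end ReducedCharpoly

/-! ### Maximal subfields -/

section MaximalSubfield

variable {F D : Type*} [Field F] [DivisionRing D] [Algebra F D] [FiniteDimensional F D]

theorem Subalgebra.isField_of_mul_comm (S : Subalgebra F D)
    (h : ∀ x ∈ S, ∀ y ∈ S, x * y = y * x) : IsField S where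
  exists_pair_ne := ⟨0, 1, zero_ne_one⟩
  mul_comm x y := Subtype.ext (h x x.2 y y.2)
  mul_inv_cancel {a} ha := by
    have hinj : Function.Injective (LinearMap.mulLeft F a) := by
      rw [injective_iff_map_eq_zero]
      intro x hx
      exact (mul_eq_zero.mp hx).resolve_left ha
    exact LinearMap.injective_iff_surjective.mp hinj 1

omit [FiniteDimensional F D] in
theorem CentralDivision.IsMaximalSubfield.mul_comm {K : Subalgebra F D}
    (hK : CentralDivision.IsMaximalSubfield K) {x y : D} (hx : x ∈ K) (hy : y ∈ K) :
    x * y = y * x :=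
  congrArg Subtype.val (hK.prop.mul_comm ⟨x, hx⟩ ⟨y, hy⟩)

/-- Adjoining `x` to `K` gives a commutative finite-dimensional subalgebra of `D`, which is a field;
maximality applies. So `K` is self-centralizing. -/
theorem CentralDivision.IsMaximalSubfield.mem_of_commute {K : Subalgebra F D}
    (hK : CentralDivision.IsMaximalSubfield K) {x : D} (hx : ∀ y ∈ K, x * y = y * x) : x ∈ K := by
  have hcomm := Algebra.isMulCommutative_adjoin F (s := insert x (K : Set D)) (by
    rintro a (rfl | ha) b (rfl | hb)
    · rfl
    · exact hx b hb
    · exact (hx a ha).symm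
    · exact hK.mul_comm ha hb)
  have hS : IsField (Algebra.adjoin F (insert x (K : Set D))) :=
    Subalgebra.isField_of_mul_comm _ fun a ha b hb =>
      congrArg Subtype.val (hcomm.is_comm.comm ⟨a, ha⟩ ⟨b, hb⟩)
  have hle : K ≤ Algebra.adjoin F (insert x (K : Set D)) := fun y hy =>
    Algebra.subset_adjoin (Set.mem_insert_of_mem _ hy)
  exact hK.le_of_ge hS hle (Algebra.subset_adjoin (Set.mem_insert _ _))

variable (F D) in
theorem exists_isMaximalSubfield :
    ∃ K : Subalgebra F D, CentralDivision.IsMaximalSubfield K := by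
  have : WellFoundedGT (Subalgebra F D) :=
    ⟨(InvImage.wf Subalgebra.toSubmodule
      (wellFounded_gt : WellFounded ((· > ·) : Submodule F D → Submodule F D → Prop)))⟩
  exact exists_maximal_of_wellFoundedGT (fun L : Subalgebra F D => IsField L)
    ⟨⊥, Subalgebra.isField_of_mul_comm _ fun x hx y hy => by
    obtain ⟨r, rfl⟩ := Algebra.mem_bot.mp hx
    exact Algebra.commutes r y⟩

end MaximalSubfield

/-! ### Independence of the choices, and uniqueness -/

section CharPoly

open CentralDivision

variable {F D : Type*} [Field F] [DivisionRing D] [Algebra F D] [FiniteDimensional F D]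

omit [FiniteDimensional F D] in
theorem CentralDivision.RightIso.charPoly_eq {K : Subalgebra F D} [IsMulCommutative K] {n m : ℕ}
    (e : RightIso K n m) (A : Matrix (Fin n) (Fin n) D) :
    e.charPoly A = (-1) ^ m * (e.rep A).charpoly := by
  have h := Matrix.det_neg (e.rep A).charmatrix
  rw [Fintype.card_fin, Matrix.charmatrix, neg_sub] at h
  rw [RightIso.charPoly, Matrix.charpoly, Matrix.charmatrix, ← h]
  congr 2
  rw [Matrix.scalar_apply, Matrix.smul_one_eq_diagonal]

theorem CentralDivision.RightIso.charpoly_rep [Algebra.IsCentral F D] {K : Subalgebra F D}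
    [IsMulCommutative K] (hK : IsMaximalSubfield K) {n m : ℕ} (e : RightIso K n m)
    (A : Matrix (Fin n) (Fin n) D) {Q : F[X]} (hQ : Q.Monic)
    (hA : ((Matrix.mulVecBilin D Dᵐᵒᵖ A).restrictScalars F).charpoly = Q ^ degree F D) :
    (e.rep A).charpoly = Q.map (algebraMap F K) := by
  let _ : Field K := hK.prop.toField
  exact charpoly_of_rightIso (L := K) K.val
    (fun x hx => ⟨⟨x, hK.mem_of_commute fun y hy => hx ⟨y, hy⟩⟩, rfl⟩) A e.g e.map_mul_right hQ hA

theorem CentralDivision.IsMaximalSubfield.exists_rightIso {K : Subalgebra F D}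
    (hK : IsMaximalSubfield K) (n : ℕ) : ∃ m, Nonempty (RightIso K n m) := by
  let _ : Field K := hK.prop.toField
  obtain ⟨m, g, hg⟩ := _root_.exists_rightIso (L := K) K.val n
  exact ⟨m, ⟨⟨g, hg⟩⟩⟩

theorem isCharPoly_of_charpoly_eq_pow [Algebra.IsCentral F D] {n : ℕ}
    (A : Matrix (Fin n) (Fin n) D) {Q : F[X]} (hQ : Q.Monic)
    (hA : ((Matrix.mulVecBilin D Dᵐᵒᵖ A).restrictScalars F).charpoly =
      Q ^ degree F D) : IsCharPoly A ((-1) ^ Q.natDegree * Q) := by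
  intro K _ hK m e
  have h := e.charpoly_rep hK A hQ hA
  -- The sign `(-1) ^ m` must not depend on the choices, so `m` is recovered from the degree.
  have hm : m = Q.natDegree := by
    have := congrArg natDegree h
    rwa [Matrix.charpoly_natDegree_eq_dim, Fintype.card_fin, hQ.natDegree_map] at this
  rw [e.charPoly_eq, h, hm]
  simp

/-- `IsCharPoly` is a universal statement, so uniqueness needs an actual maximal subfield and an
actual isomorphism. -/
theorem IsCharPoly.unique {n : ℕ} {A : Matrix (Fin n) (Fin n) D} {Φ Ψ : F[X]}
    (hΦ : IsCharPoly A Φ) (hΨ : IsCharPoly A Ψ) : Φ = Ψ := by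
  obtain ⟨K, hK⟩ := exists_isMaximalSubfield F D
  obtain ⟨m, ⟨e⟩⟩ := hK.exists_rightIso n
  have : IsMulCommutative K := ⟨⟨hK.prop.mul_comm⟩⟩
  exact Polynomial.map_injective _ (algebraMap F K).injective
    ((hΦ K hK m e).trans (hΨ K hK m e).symm)

end CharPoly

/-! ### Roots of the characteristic polynomial as right eigenvalues -/

section Eigenvectors

/-- An operator annihilated by an irreducible `p` over the center has every root of `p` in `E`
as an eigenvalue. -/
theorem exists_apply_eq_smul_of_aeval_eq_zero {F E W : Type*} [Field F] [DivisionRing E]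
    [Algebra F E] [Algebra.IsCentral F E] [AddCommGroup W] [Module F W] [Module E W]
    [IsScalarTower F E W] [Nontrivial W] (T : Module.End E W) {p : F[X]} (hp : Irreducible p)
    (hm : p.Monic) (hT : aeval T p = 0) {y : E} (hy : aeval y p = 0) :
    ∃ w ≠ 0, T w = y • w := by
  -- Horner's scheme: `g (i + 1)` is the coefficient of `zⁱ` in the quotient of `p` by `z - y`, and
  -- `g 0 = p(y) = 0`.
  let g : ℕ → E := fun i => aeval y (divX^[i] p)
  have hcoeff : ∀ i k, (divX^[i] p).coeff k = p.coeff (k + i) := by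
    intro i
    induction i with
    | zero => intro k; rfl
    | succ i ih => intro k; rw [Function.iterate_succ_apply', coeff_divX, ih]; congr 1; ring
  have hg : ∀ i, y * g (i + 1) = g i - algebraMap F E (p.coeff i) := by
    intro i
    have h := congrArg (aeval y) (X_mul_divX_add (divX^[i] p))
    rw [map_add, map_mul, aeval_X, aeval_C, hcoeff, zero_add] at h
    simp only [g, Function.iterate_succ_apply']
    exact eq_sub_of_add_eq h
  have hgN : g p.natDegree = 1 := by
    have : divX^[p.natDegree] p = 1 := by
      ext k
      rw [hcoeff, coeff_one]
      split_ifs with hk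
      · rw [hk, zero_add]; exact hm
      · exact coeff_eq_zero_of_natDegree_lt (by omega)
    simp [g, this]
  let G : W → W := fun w => ∑ i ∈ Finset.range p.natDegree, g (i + 1) • (T ^ i) w
  have hG : ∀ w, T (G w) = y • G w := by
    intro w
    have h1 : ∀ i, (T ^ (i + 1)) w = T ((T ^ i) w) := fun i => by
      rw [pow_succ', Module.End.mul_apply]
    have h2 : T (G w) - y • G w = ∑ i ∈ Finset.range p.natDegree,
        (g (i + 1) • (T ^ (i + 1)) w - g i • (T ^ i) w) +
        ∑ i ∈ Finset.range p.natDegree, p.coeff i • (T ^ i) w := by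
      rw [map_sum, Finset.smul_sum, ← Finset.sum_sub_distrib, ← Finset.sum_add_distrib]
      refine Finset.sum_congr rfl fun i _ => ?_
      rw [smul_smul, hg, sub_smul, algebraMap_smul, map_smul, h1]
      abel
    have h3 := LinearMap.congr_fun hT w
    rw [aeval_eq_sum_range, Finset.sum_range_succ, hm.coeff_natDegree, one_smul] at h3
    rw [Finset.sum_range_sub (fun i => g i • (T ^ i) w), hgN, one_smul] at h2
    have h4 : g 0 = 0 := hy
    rw [h4, zero_smul, sub_zero] at h2
    rw [← sub_eq_zero, h2]
    simpa [add_comm] using h3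
  by_contra! hne
  have hG0 : ∀ w, G w = 0 := fun w => by
    by_contra h
    exact hne _ h (hG w)
  -- The powers of `T` below the degree of `p` are independent over `F`, hence over `E`; but the top
  -- coefficient in `G` is `1`, so `G` cannot vanish identically.
  have hmin : p = minpoly F T := minpoly.eq_of_irreducible_of_monic hp hT hm
  have hind : LinearIndependent F fun i : Fin p.natDegree => T ^ (i : ℕ) := by
    rw [hmin]
    exact linearIndependent_pow T
  have hzero := eq_zero_of_sum_smul_end_eq_zero hind Finset.univ (fun i => g (i + 1)) (fun w => by
    rw [Fin.sum_univ_eq_sum_range (fun i => g (i + 1) • (T ^ i) w)]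
    exact hG0 w)
  have hpos := hp.natDegree_pos
  have := hzero ⟨p.natDegree - 1, by omega⟩ (Finset.mem_univ _)
  simp only [Nat.sub_add_cancel hpos, hgN] at this
  exact one_ne_zero this

/-- Every root in `D` of the characteristic polynomial over the center is a right eigenvalue. -/
theorem exists_mulVec_eq_of_aeval_charpoly {F D : Type*} [Field F] [DivisionRing D]
    [Algebra F D] [Algebra.IsCentral F D] [FiniteDimensional F D] {n : ℕ}
    (A : Matrix (Fin n) (Fin n) D) {y : D}
    (hy : aeval y ((Matrix.mulVecBilin D Dᵐᵒᵖ A).restrictScalars F).charpoly = 0) :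
    ∃ w ≠ 0, A.mulVec w = fun i => w i * y := by
  let T : Module.End Dᵐᵒᵖ (Fin n → D) := Matrix.mulVecBilin D Dᵐᵒᵖ A
  have hint : IsIntegral F y := Algebra.IsIntegral.isIntegral y
  let p := minpoly F y
  have hp : Irreducible p := minpoly.irreducible hint
  obtain ⟨v, hv, hpv⟩ := exists_ne_zero_aeval_apply_eq_zero (T.restrictScalars F)
    (minpoly.degree_pos hint).ne' (minpoly.dvd F y hy)
  have hpv' : aeval T p v = 0 :=
    (map_aeval_apply_of_intertwine (T.restrictScalars F) T LinearMap.id (fun _ => rfl) p v).symm.trans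
      hpv
  let U : Submodule Dᵐᵒᵖ (Fin n → D) := LinearMap.ker (aeval T p)
  have hU : ∀ w ∈ U, T w ∈ U := fun w hw =>
    (map_aeval_apply_of_intertwine T T (T.restrictScalars F) (fun _ => rfl) p w).symm.trans
      ((congrArg T hw).trans (map_zero T))
  have : Nontrivial U := ⟨⟨⟨v, hpv'⟩, 0, fun h => hv (congrArg Subtype.val h)⟩⟩
  have hann : aeval (T.restrict hU) p = 0 := LinearMap.ext fun w => Subtype.ext <|
    (map_aeval_apply_of_intertwine (T.restrict hU) T (U.subtype.restrictScalars F)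
      (fun _ => rfl) p w).trans w.2
  have hop : aeval (MulOpposite.op y) p = 0 := by
    have h : aeval y p = 0 := minpoly.aeval F y
    rw [aeval_eq_sum_range] at h ⊢
    rw [← MulOpposite.op_zero, ← h]
    simp
  obtain ⟨w, hw, h⟩ := exists_apply_eq_smul_of_aeval_eq_zero (T.restrict hU) hp (minpoly.monic hint)
    hann hop
  exact ⟨w, fun h0 => hw (Subtype.ext h0), congrArg Subtype.val h⟩

end Eigenvectors

/-! ### Eigenvectors of the companion matrix -/

section Companion

open CentralDivision

variable {D : Type*} [DivisionRing D]

theorem companionMatrix_mulVec_apply (φ : D[X]) (v : ℕ → D) (i : Fin φ.natDegree) :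
    (companionMatrix φ).mulVec (fun k => v k) i =
      if (i : ℕ) + 1 = φ.natDegree then -∑ k ∈ Finset.range φ.natDegree, φ.coeff k * v k
      else v (i + 1) := by
  rw [Matrix.mulVec, dotProduct]
  simp only [companionMatrix, Matrix.of_apply]
  split_ifs with h
  · rw [← Finset.sum_neg_distrib, ← Fin.sum_univ_eq_sum_range (fun k => -(φ.coeff k * v k))]
    simp
  · have hi : (i : ℕ) + 1 < φ.natDegree := by omega
    rw [Finset.sum_eq_single ⟨i + 1, hi⟩]
    · simp
    · intro k _ hk
      rw [if_neg (fun h' => hk (Fin.ext h')), zero_mul]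
    · simp

theorem sum_range_coeff_mul_pow_of_isRoot {φ : D[X]} (hφ : φ.Monic) (x : D) :
    φ.IsRoot x ↔ -∑ k ∈ Finset.range φ.natDegree, φ.coeff k * x ^ k = x ^ φ.natDegree := by
  rw [IsRoot, eval_eq_sum_range, Finset.sum_range_succ, hφ.coeff_natDegree, one_mul,
    neg_eq_iff_add_eq_zero]

variable {F : Type*} [Field F] [Algebra F D] [FiniteDimensional F D]

/-- Roots of `φ` are roots of the characteristic polynomial over `F` of the companion matrix. -/
theorem aeval_charpoly_companionMatrix_of_isRoot {φ : D[X]} (hφ : φ.Monic) {x : D}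
    (hx : φ.IsRoot x) : aeval x
      ((Matrix.mulVecBilin D Dᵐᵒᵖ (companionMatrix φ)).restrictScalars F).charpoly = 0 := by
  have hpos : 0 < φ.natDegree := by
    rw [Nat.pos_iff_ne_zero]
    intro h0
    rw [hφ.natDegree_eq_zero.mp h0] at hx
    simp at hx
  let T := (Matrix.mulVecBilin D Dᵐᵒᵖ (companionMatrix φ)).restrictScalars F
  -- This intertwines left multiplication by `x` with `T`. Entry `0` of `g` is the identity, so
  -- Cayley–Hamilton for `T` can be read off there.
  let g : D →ₗ[F] (Fin φ.natDegree → D) := LinearMap.pi fun i => LinearMap.mulLeft F (x ^ (i : ℕ))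
  have hg : ∀ v, g (Algebra.lmul F D x v) = T (g v) := by
    intro v
    ext i
    change x ^ (i : ℕ) * (x * v) = (companionMatrix φ).mulVec (fun k => x ^ (k : ℕ) * v) i
    rw [companionMatrix_mulVec_apply φ (fun k => x ^ k * v)]
    split_ifs with h
    · simp only [← mul_assoc]
      rw [← Finset.sum_mul, ← neg_mul, (sum_range_coeff_mul_pow_of_isRoot hφ x).mp hx, ← pow_succ, h]
    · rw [← mul_assoc, pow_succ]
  have h := map_aeval_apply_of_intertwine _ T g hg T.charpoly 1
  rw [LinearMap.aeval_self_charpoly, LinearMap.zero_apply, aeval_algHom_apply] at h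
  have h0 := congrFun h ⟨0, hpos⟩
  simpa [g] using h0

/-- All rows but the last force `w k = w 0 * y ^ k`, so `w 0 ≠ 0`. The last row, multiplied on the
right by `(w 0)⁻¹`, says that `w 0 * y * (w 0)⁻¹` is a root. -/
theorem exists_isConj_isRoot_of_mulVec_eq {φ : D[X]} (hφ : φ.Monic) {y : D}
    {w : Fin φ.natDegree → D} (hw : w ≠ 0)
    (h : (companionMatrix φ).mulVec w = fun i => w i * y) : ∃ x, IsConj y x ∧ φ.IsRoot x := by
  have hpos : 0 < φ.natDegree := by
    rw [Nat.pos_iff_ne_zero]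
    intro h0
    have : IsEmpty (Fin φ.natDegree) := by rw [h0]; infer_instance
    exact hw (Subsingleton.elim _ _)
  -- Extending by zero allows writing `v (i + 1)` freely; the default is never used, as the last row
  -- is treated apart.
  let v : ℕ → D := fun k => if hk : k < φ.natDegree then w ⟨k, hk⟩ else 0
  have hv : w = fun k : Fin φ.natDegree => v k := by
    ext k
    simp [v]
  rw [hv] at h
  have hi : ∀ i : Fin φ.natDegree, _ = v i * y := fun i =>
    (companionMatrix_mulVec_apply φ v i).symm.trans (congrFun h i)
  have hpow : ∀ k, k < φ.natDegree → v k = v 0 * y ^ k := by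
    intro k
    induction k with
    | zero => simp
    | succ k ih =>
      intro hk
      have := hi ⟨k, by omega⟩
      rw [if_neg (by simpa using hk.ne)] at this
      rw [this, ih (by omega), mul_assoc, pow_succ]
  have hv0 : v 0 ≠ 0 := fun h0 => hw (by
    rw [hv]
    ext k
    rw [hpow k k.2, h0, zero_mul, Pi.zero_apply])
  have hlast := hi ⟨φ.natDegree - 1, by omega⟩
  rw [if_pos (Nat.sub_add_cancel hpos), hpow _ (by simpa using hpos), mul_assoc, ← pow_succ,
    Nat.sub_add_cancel hpos] at hlast
  have hconj : ∀ k, (v 0 * y * (v 0)⁻¹) ^ k = v 0 * y ^ k * (v 0)⁻¹ := by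
    intro k
    induction k with
    | zero => simp [hv0]
    | succ k ih => rw [pow_succ, ih, pow_succ]; simp [mul_assoc, hv0]
  refine ⟨v 0 * y * (v 0)⁻¹, ⟨Units.mk0 (v 0) hv0, by simp [SemiconjBy, hv0]⟩, ?_⟩
  rw [sum_range_coeff_mul_pow_of_isRoot hφ, hconj, ← hlast, neg_mul, Finset.sum_mul]
  congr 1
  refine Finset.sum_congr rfl fun k hk => ?_
  rw [hconj, hpow k (Finset.mem_range.mp hk), mul_assoc, mul_assoc, mul_assoc]

end Companion

theorem theorem3 {F D : Type*} [Field F] [DivisionRing D] [Algebra F D]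
    [Algebra.IsCentral F D] [FiniteDimensional F D]
    (φ : Polynomial D) (hφ : φ.Monic) :
    (∃! Φ : Polynomial F, CentralDivision.IsCompanionPolynomial φ Φ) ∧
    ∀ Φ : Polynomial F, CentralDivision.IsCompanionPolynomial φ Φ →
      Φ.natDegree = φ.natDegree * CentralDivision.degree F D ∧
      (∀ x : D, φ.IsRoot x → Polynomial.aeval x Φ = 0) ∧
      (∀ y : D, Polynomial.aeval y Φ = 0 → ∃ x : D, IsConj y x ∧ φ.IsRoot x) := by
  obtain ⟨Q, hQ, hdeg, hpow⟩ := exists_monic_charpoly_mulVec_eq_pow (F := F) φ.natDegree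
    (CentralDivision.companionMatrix φ)
  have hex := isCharPoly_of_charpoly_eq_pow _ hQ hpow
  refine ⟨⟨_, hex, fun Ψ hΨ => IsCharPoly.unique hΨ hex⟩, fun Φ hΦ => ?_⟩
  obtain rfl : Φ = _ := IsCharPoly.unique hΦ hex
  have haeval : ∀ x : D, aeval x ((-1) ^ Q.natDegree * Q) = 0 ↔ aeval x Q = 0 := fun x => by
    simp
  simp only [haeval]
  refine ⟨?_, fun x hx => ?_, fun y hy => ?_⟩
  · rw [← hdeg]
    rcases neg_one_pow_eq_or F[X] Q.natDegree with h | h <;> simp [h]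
  · have := aeval_charpoly_companionMatrix_of_isRoot (F := F) hφ hx
    rw [hpow, map_pow] at this
    exact pow_eq_zero_iff (degree_pos F D).ne' |>.mp this
  · obtain ⟨w, hw, h⟩ := exists_mulVec_eq_of_aeval_charpoly (F := F)
      (CentralDivision.companionMatrix φ) (y := y)
      (by rw [hpow, map_pow, hy, zero_pow (degree_pos F D).ne'])
    exact exists_isConj_isRoot_of_mulVec_eq hφ hw h
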